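/- Let $k\ge 1$ and $n_1,\dots,n_k\ge 2$ be integers. For each $i$ let $F^2(H_{n_i})$ be the full Fock space over an $n_i$-dimensional complex Hilbert space, with orthonormal basis $e^i_\alpha$ indexed by the words $\alpha$ in the free monoid $\mathbb F_{n_i}^+$ with generators $g^i_1,\dots,g^i_{n_i}$; let $S_{i,j}e^i_\alpha=e^i_{g^i_j\alpha}$ be the left creation operators, and let $\mathbf S_{i,j}$ be the operator on $\bigotimes_{i=1}^kF^2(H_{n_i})$ acting as $S_{i,j}$ on the $i$-th factor and as the identity on the others. Let $\mathcal H$ be a complex Hilbert space and $\mathbf S\otimes I:=(\mathbf S_{i,j}\otimes I_{\mathcal H})_{i,j}$. For a tuple $\mathbf T=(T_{i,j})_{1\le i\le k,\,1\le j\le n_i}$ of bounded operators on a Hilbert space $\mathcal X$ put $\Phi_{T_i}(Y)=\sum_{j=1}^{n_i}T_{i,j}YT_{i,j}^*$ and $\mathbf\Delta_{\mathbf T}=(\mathrm{id}-\Phi_{T_1})\circ\cdots\circ(\mathrm{id}-\Phi_{T_k})$. If $\mathbf\Delta_{\mathbf T}(I)$ has finite rank, we say that $\mathbf T$ has finite rank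 and put $\operatorname{rank}\mathbf T:=\operatorname{rank}\mathbf\Delta_{\mathbf T}(I)$. In that case, for $\mathbf q\in\mathbb Z_+^k$ let $$M_{\mathbf q}(\mathbf T)=\operatorname{span}\{T_{1,\alpha_1}\cdots T_{k,\alpha_k}h:\ \alpha_i\in\mathbb F_{n_i}^+,\ |\alpha_i|\le q_i,\ h\in\mathbf\Delta_{\mathbf T}(I)(\mathcal X)\},$$ where $T_{i,\alpha}=T_{i,j_1}\cdots T_{i,j_p}$ for $\alpha=g^i_{j_1}\cdots g^i_{j_p}$, and define the Euler characteristic $$\chi(\mathbf T)=\lim_{m\to\infty}\frac{\dim M_{\mathbf q^{(m)}}(\mathbf T)}{\prod_{i=1}^k(1+n_i+\cdots+n_i^{q_i^{(m)}})},$$ where $(\mathbf q^{(m)})$ is any increasing cofinal sequence in $\mathbb Z_+^k$, provided that the limit exists for every such sequence and does not depend on it. Theorem. Let $\mathcal M$ and $\mathcal N$ be closed subspaces of $\bigotimes_{i=1}^kF^2(H_{n_i})\otimes\mathcal H$ that are invariant under every $\mathbf S_{i,j}\otimes I_{\mathcal H}$ and contain no nonzero closed subspace reducing all of these operators. Assume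 that the defect operators $\Delta_{\mathcal M}:=\mathbf\Delta_{\mathbf S\otimes I}(P_{\mathcal M})$ and $\Delta_{\mathcal N}:=\mathbf\Delta_{\mathbf S\otimes I}(P_{\mathcal N})$, where $P_{\mathcal M},P_{\mathcal N}$ are the orthogonal projections onto $\mathcal M,\mathcal N$, are positive (semidefinite) and of finite rank. Then the restricted tuples $(\mathbf S\otimes I)|_{\mathcal M}$ and $(\mathbf S\otimes I)|_{\mathcal N}$ have finite rank, their Euler characteristics exist, and $$\chi((\mathbf S\otimes I)|_{\mathcal M})=\operatorname{rank}\,(\mathbf S\otimes I)|_{\mathcal M},\qquad \chi((\mathbf S\otimes I)|_{\mathcal N})=\operatorname{rank}\,(\mathbf S\otimes I)|_{\mathcal N}.$$ Moreover $\mathcal M$ and $\mathcal N$ are unitarily equivalent, i.e. there is a unitary $U:\mathcal M\to\mathcal N$ with $U(\mathbf S_{i,j}\otimes I)|_{\mathcal M}=(\mathbf S_{i,j}\otimes I)|_{\mathcal N}U$ for all $i,j$, if and only if $$\chi((\mathbf S\otimes I)|_{\mathcal M})=\chi((\mathbf S\otimes I)|_{\mathcal N}).$$ -/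

import Mathlib

open Filter Topology

namespace Polyball

noncomputable section

/-! ### Tuples of operators, defect maps and the Euler characteristic -/

section Tuples

variable {X : Type*} [NormedAddCommGroup X] [InnerProductSpace ℂ X]

/-- A tuple `T = (T_1, …, T_k)` of row tuples `T_i = (T_{i,1}, …, T_{i,n_i})` of bounded operators
on a complex Hilbert space `X`. -/
abbrev OpTuple {k : ℕ} (n : Fin k → ℕ) (X : Type*) [NormedAddCommGroup X]
    [InnerProductSpace ℂ X] : Type _ :=
  ∀ i : Fin k, Fin (n i) → (X →L[ℂ] X)

/-- The completely positive map `Φ_A(Y) = ∑_j A_j Y A_j^*` of a finite family of operators. -/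
def cpMap [CompleteSpace X] {m : ℕ} (A : Fin m → (X →L[ℂ] X)) :
    Module.End ℂ (X →L[ℂ] X) where
  toFun Y := ∑ j, A j ∘L Y ∘L ContinuousLinearMap.adjoint (A j)
  map_add' Y Z := by
    simp [ContinuousLinearMap.add_comp, ContinuousLinearMap.comp_add, Finset.sum_add_distrib]
  map_smul' c Y := by
    simp [ContinuousLinearMap.smul_comp, Finset.smul_sum]

/-- The defect map `(id - Φ_{T_1}) ∘ ⋯ ∘ (id - Φ_{T_k})`
(multiplication in `Module.End` is composition). -/
def defectMap [CompleteSpace X] {k : ℕ} {n : Fin k → ℕ} (T : OpTuple n X) :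
    Module.End ℂ (X →L[ℂ] X) :=
  (List.ofFn fun i => 1 - cpMap (T i)).prod

/-- The defect operator `Δ_T(I)` of a tuple. -/
def defect [CompleteSpace X] {k : ℕ} {n : Fin k → ℕ} (T : OpTuple n X) : X →L[ℂ] X :=
  defectMap T (ContinuousLinearMap.id ℂ X)

/-- A bounded operator has finite rank if its range is finite-dimensional. -/
def IsFiniteRank (A : X →L[ℂ] X) : Prop :=
  FiniteDimensional ℂ (A : X →ₗ[ℂ] X).range

/-- The rank of a tuple: the dimension of the range of its defect operator (used only when that
range is finite-dimensional). -/
def tupleRank [CompleteSpace X] {k : ℕ} {n : Fin k → ℕ} (T : OpTuple n X) : ℕ :=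
  Module.finrank ℂ (defect T : X →ₗ[ℂ] X).range

/-- The operator `T_{1,α_1} ⋯ T_{k,α_k}` where, for a word `α_i = g_{j_1} ⋯ g_{j_p}`,
`T_{i,α_i} = T_{i,j_1} ⋯ T_{i,j_p}`. -/
def wordOp {k : ℕ} {n : Fin k → ℕ} (T : OpTuple n X) (α : ∀ i, FreeMonoid (Fin (n i))) :
    X →L[ℂ] X :=
  (List.ofFn fun i => FreeMonoid.lift (T i) (α i)).prod

/-- The linear manifold `M_q(T)`, the span of the vectors `T_{1,α_1} ⋯ T_{k,α_k} h` with
`|α_i| ≤ q_i` and `h` in the range of the defect operator of `T`. -/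
def levelSpan [CompleteSpace X] {k : ℕ} {n : Fin k → ℕ} (T : OpTuple n X) (q : Fin k → ℕ) :
    Submodule ℂ X :=
  Submodule.span ℂ {x | ∃ (α : ∀ i, FreeMonoid (Fin (n i))) (h : X),
    (∀ i, (α i).length ≤ q i) ∧ h ∈ (defect T : X →ₗ[ℂ] X).range ∧ x = wordOp T α h}

/-- The quotient `dim M_q(T) / ∏_i (1 + n_i + ⋯ + n_i^{q_i})`. -/
def eulerRatio [CompleteSpace X] {k : ℕ} {n : Fin k → ℕ} (T : OpTuple n X) (q : Fin k → ℕ) : ℝ :=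
  (Module.finrank ℂ (levelSpan T q) : ℝ) /
    ∏ i, ∑ s ∈ Finset.range (q i + 1), (n i : ℝ) ^ s

/-- The Euler characteristic of the tuple `T` exists and equals `c`: the defect of `T` has finite
rank and along every increasing cofinal sequence in `ℕ^k` the quotients `eulerRatio` tend to `c`. -/
def HasEulerChar [CompleteSpace X] {k : ℕ} {n : Fin k → ℕ} (T : OpTuple n X) (c : ℝ) : Prop :=
  IsFiniteRank (defect T) ∧
    ∀ q : ℕ → Fin k → ℕ, Monotone q → (∀ p, ∃ m, p ≤ q m) →
      Tendsto (fun m => eulerRatio T (q m)) atTop (𝓝 c)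

theorem HasEulerChar.unique [CompleteSpace X] {k : ℕ} {n : Fin k → ℕ} {T : OpTuple n X} {c d : ℝ}
    (hc : HasEulerChar T c) (hd : HasEulerChar T d) : c = d := by
  have h1 : Monotone (fun (m : ℕ) (_ : Fin k) => m) := fun a b hab _ => hab
  have h2 : ∀ p : Fin k → ℕ, ∃ m : ℕ, p ≤ fun _ => m := fun p =>
    ⟨∑ i, p i, fun i => Finset.single_le_sum (fun _ _ => Nat.zero_le _) (Finset.mem_univ i)⟩
  exact tendsto_nhds_unique (hc.2 _ h1 h2) (hd.2 _ h1 h2)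

/-- The Euler characteristic `χ(T)` (the unique `c` with `HasEulerChar T c`, if there is one). -/
def eulerChar [CompleteSpace X] {k : ℕ} {n : Fin k → ℕ} (T : OpTuple n X) : ℝ :=
  Classical.epsilon (HasEulerChar T)

/-- `M` is invariant under every operator of the tuple. -/
def IsInvariant {k : ℕ} {n : Fin k → ℕ} (T : OpTuple n X) (M : Submodule ℂ X) : Prop :=
  ∀ i j, ∀ x ∈ M, T i j x ∈ M

/-- `R` is a reducing subspace: closed and invariant under every operator of the tuple and under
every adjoint. -/
def IsReducing [CompleteSpace X] {k : ℕ} {n : Fin k → ℕ} (T : OpTuple n X)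
    (R : Submodule ℂ X) : Prop :=
  IsClosed (R : Set X) ∧ IsInvariant T R ∧
    IsInvariant (fun i j => ContinuousLinearMap.adjoint (T i j)) R

/-- `M` contains no nonzero reducing subspace of the tuple. -/
def ContainsNoReducing [CompleteSpace X] {k : ℕ} {n : Fin k → ℕ} (T : OpTuple n X)
    (M : Submodule ℂ X) : Prop :=
  ∀ R : Submodule ℂ X, IsReducing T R → R ≤ M → R = ⊥

/-- The restriction `T|_M` of a tuple to an invariant subspace. -/
def restrictTuple {k : ℕ} {n : Fin k → ℕ} (T : OpTuple n X) (M : Submodule ℂ X)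
    (hM : IsInvariant T M) : OpTuple n M :=
  fun i j => (T i j).restrict (hM i j)

/-- Two tuples on Hilbert spaces are unitarily equivalent. -/
def UnitarilyEquivalent {Y : Type*} [NormedAddCommGroup Y] [InnerProductSpace ℂ Y]
    {k : ℕ} {n : Fin k → ℕ} (T : OpTuple n X) (T' : OpTuple n Y) : Prop :=
  ∃ U : X ≃ₗᵢ[ℂ] Y, ∀ i j x, U (T i j x) = T' i j (U x)

end Tuples

/-! ### The universal model on the tensor product of full Fock spaces -/

section Fock

variable {k : ℕ} (n : Fin k → ℕ) (H : Type*) [NormedAddCommGroup H] [InnerProductSpace ℂ H]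

/-- The index set `F_{n_1}^+ × ⋯ × F_{n_k}^+` of tuples of words. -/
abbrev Words : Type := ∀ i : Fin k, FreeMonoid (Fin (n i))

/-- The Hilbert space `F²(H_{n_1}) ⊗ ⋯ ⊗ F²(H_{n_k}) ⊗ H`. Since the vectors
`e_{β_1} ⊗ ⋯ ⊗ e_{β_k}`, indexed by tuples of words, are an orthonormal basis of
`F²(H_{n_1}) ⊗ ⋯ ⊗ F²(H_{n_k})`, the tensor product with `H` is the Hilbert space of square
summable families `(f β)` in `H`, the family `f` standing for `∑_β e_{β_1} ⊗ ⋯ ⊗ e_{β_k} ⊗ f β`. -/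
abbrev FockTensor : Type _ := lp (fun _ : Words n => H) 2

open scoped Classical in
variable {H} in
/-- The vector `e_{β_1} ⊗ ⋯ ⊗ e_{β_k} ⊗ h`, as an isometric linear function of `h`. -/
def basisTensor (β : Words n) : H →ₗᵢ[ℂ] FockTensor n H where
  toLinearMap := lp.lsingle (𝕜 := ℂ) (E := fun _ : Words n => H) 2 β
  norm_map' h := lp.norm_single (E := fun _ : Words n => H) (p := 2) (by norm_num) β h

variable {n} in
/-- Put the letter `g_j` in front of the `i`-th word. -/
def prepend (i : Fin k) (j : Fin (n i)) (β : Words n) : Words n :=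
  Function.update β i (FreeMonoid.of j * β i)

theorem prepend_injective (i : Fin k) (j : Fin (n i)) :
    Function.Injective (prepend (n := n) i j) := by
  intro β γ h
  funext a
  have ha := congrFun h a
  by_cases hai : a = i
  · subst hai
    simpa [prepend] using ha
  · simpa [prepend, hai] using ha

open scoped Classical in
theorem basisTensor_orthogonal (i : Fin k) (j : Fin (n i)) :
    OrthogonalFamily ℂ (fun _ : Words n => H) (fun β => basisTensor n (prepend i j β)) := by
  intro β γ hβγ x y
  have h : prepend i j β ≠ prepend i j γ := fun h => hβγ (prepend_injective n i j h)
  change inner ℂ (lp.single 2 (prepend i j β) x : FockTensor n H)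
    (lp.single 2 (prepend i j γ) y) = 0
  rw [lp.inner_single_left]
  simp [Pi.single_eq_of_ne h]

variable [CompleteSpace H]

/-- The ampliated left creation operators `𝐒_{i,j} ⊗ I_H`: the isometries determined by
`e_{β_1} ⊗ ⋯ ⊗ e_{β_k} ⊗ h ↦ e_{β_1} ⊗ ⋯ ⊗ e_{g_j β_i} ⊗ ⋯ ⊗ e_{β_k} ⊗ h`. -/
def universalModel : OpTuple n (FockTensor n H) := fun i j =>
  (basisTensor_orthogonal n H i j).linearIsometry.toContinuousLinearMap

open scoped Classical in
theorem universalModel_basisTensor (i : Fin k) (j : Fin (n i)) (β : Words n) (h : H) :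
    universalModel n H i j (basisTensor n β h) = basisTensor n (prepend i j β) h :=
  (basisTensor_orthogonal n H i j).linearIsometry_apply_single h

/-- The defect operator `Δ_M = Δ_{S ⊗ I}(P_M)` of a closed subspace `M`, where `P_M` is the
orthogonal projection onto `M`. -/
def subspaceDefect (M : Submodule ℂ (FockTensor n H)) [CompleteSpace M] :
    FockTensor n H →L[ℂ] FockTensor n H :=
  defectMap (universalModel n H) M.starProjection

variable {n H} in
/-- The restricted tuple `(𝐒 ⊗ I_H)|_M` for an invariant subspace `M`. -/
abbrev restrictedModel {M : Submodule ℂ (FockTensor n H)}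
    (hM : IsInvariant (universalModel n H) M) : OpTuple n M :=
  restrictTuple (universalModel n H) M hM

end Fock

end

end Polyball

namespace Polyball

noncomputable section

/-! ### Words and the shifts on basis vectors -/

section Shifts

variable {k : ℕ} {n : Fin k → ℕ} {H : Type*} [NormedAddCommGroup H] [InnerProductSpace ℂ H]

/-! The point is that a positive defect `Δ_M` is automatically the orthogonal projection onto a
wandering subspace: the translates `S_α (ran Δ_M)` are mutually orthogonal and span a dense subspace
of `M`. So the restricted tuple is a copy of the universal model with multiplicity `d = rank`, and
both assertions can be read off a basis.

Telescoping `id - Φ_{S_i}` gives `Y = ∑_α S_α Δ(Y) S_α^*`, a finite sum on each basis vector because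
`S_α^*` kills words that do not start with `α` (`sum_shiftConj_defectMap`). If `Δ(P_M) = B^* B`,
then `x ↦ (B S_α^* x)_α` is bounded and factors `P_M` (`exists_factorization`), so `‖x‖² = ∑_β ‖B
S_β^* x‖²` for `x ∈ M`. Apply this identity to `S_α x`, which has the same norm: the terms with `β =
αγ` are the terms for `x` and already use up the whole sum, so all others vanish
(`subspaceDefect_coshift_shift_of_not_exists`). This yields orthogonality of the translates,
idempotence of `Δ_M` and, by the same identity, completeness
(`exists_hilbertBasis_restrictedModel`).

In such a basis `dim M_q` is exactly `d` times the size of the box of words, so the Euler quotient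
is constantly `d`. Equal `d` lets the two bases be matched by an intertwining unitary; conversely
the rank is a unitary invariant. -/

theorem mul_words_right_inj {α β γ : Words n} : α * β = α * γ ↔ β = γ := by
  refine ⟨fun h => funext fun i => ?_, fun h => h ▸ rfl⟩
  exact mul_left_cancel (congrFun h i)

open scoped Classical in
theorem basisTensor_eq_single (β : Words n) (h : H) :
    basisTensor n β h = lp.single 2 β h := rfl

open scoped Classical in
theorem basisTensor_apply (β γ : Words n) (h : H) :
    (basisTensor n β h : FockTensor n H) γ = if γ = β then h else 0 := by
  rw [basisTensor_eq_single, lp.single_apply]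
  by_cases hg : γ = β
  · subst hg; simp
  · simp [hg]

theorem inner_basisTensor_left (β : Words n) (h : H) (x : FockTensor n H) :
    inner ℂ (basisTensor n β h) x = inner ℂ h (x β) := by
  classical
  rw [basisTensor_eq_single]
  convert lp.inner_single_left (𝕜 := ℂ) β h x

theorem hasSum_basisTensor (x : FockTensor n H) :
    HasSum (fun β => basisTensor n β (x β)) x := by
  classical
  have := lp.hasSum_single (p := 2) (by norm_num) x
  convert this using 2 with β
  exact basisTensor_eq_single β _

theorem clm_ext_basisTensor {Y : Type*} [NormedAddCommGroup Y] [InnerProductSpace ℂ Y]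
    {f g : FockTensor n H →L[ℂ] Y}
    (hfg : ∀ β h, f (basisTensor n β h) = g (basisTensor n β h)) : f = g := by
  ext x
  have hf := (hasSum_basisTensor x).mapL f
  have hg := (hasSum_basisTensor x).mapL g
  simp only [hfg] at hf
  exact hf.unique hg

variable [CompleteSpace H]

theorem lift_universalModel_basisTensor (i : Fin k) (w : FreeMonoid (Fin (n i))) (β : Words n)
    (h : H) : FreeMonoid.lift (universalModel n H i) w (basisTensor n β h) =
      basisTensor n (Function.update β i (w * β i)) h := by
  induction w using FreeMonoid.inductionOn' with
  | one => simp
  | of_mul j w ih =>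
    rw [map_mul, mul_apply_eq_comp, ih, FreeMonoid.lift_eval_of,
      universalModel_basisTensor]
    simp [prepend, mul_assoc]

theorem wordOp_universalModel_basisTensor (α β : Words n) (h : H) :
    wordOp (universalModel n H) α (basisTensor n β h) = basisTensor n (α * β) h := by
  -- The product is evaluated over duplicate-free lists of coordinates, so that each factor acts on
  -- a coordinate not yet changed.
  have key : ∀ L : List (Fin k), L.Nodup →
      (L.map fun i => FreeMonoid.lift (universalModel n H i) (α i)).prod (basisTensor n β h) =
        basisTensor n (fun i => if i ∈ L then α i * β i else β i) h := by
    intro L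
    induction L with
    | nil => simp
    | cons a L ih =>
      intro hL
      rw [List.nodup_cons] at hL
      rw [List.map_cons, List.prod_cons, mul_apply_eq_comp, ih hL.2,
        lift_universalModel_basisTensor]
      congr 2
      funext i
      by_cases hi : i = a
      · subst hi; simp [hL.1]
      · simp [hi]
  rw [wordOp, List.ofFn_eq_map, key _ (List.nodup_finRange k)]
  simp only [List.mem_finRange, if_true]
  rfl

variable (n H) in
/-- The ampliated creation operators indexed by tuples of words, as a monoid homomorphism. -/
def shift : Words n →* (FockTensor n H →L[ℂ] FockTensor n H) where
  toFun := wordOp (universalModel n H)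
  map_one' := clm_ext_basisTensor fun β h => by
    rw [wordOp_universalModel_basisTensor, one_mul]; rfl
  map_mul' α γ := clm_ext_basisTensor fun β h => by
    simp [wordOp_universalModel_basisTensor, mul_assoc]

@[simp]
theorem shift_basisTensor (α β : Words n) (h : H) :
    shift n H α (basisTensor n β h) = basisTensor n (α * β) h :=
  wordOp_universalModel_basisTensor α β h

theorem prepend_eq_mulSingle_mul (i : Fin k) (j : Fin (n i)) (β : Words n) :
    prepend i j β = Pi.mulSingle i (FreeMonoid.of j) * β := by
  funext a
  by_cases ha : a = i
  · subst ha; simp [prepend]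
  · simp [prepend, ha]

theorem universalModel_eq_shift (i : Fin k) (j : Fin (n i)) :
    universalModel n H i j = shift n H (Pi.mulSingle i (FreeMonoid.of j)) :=
  clm_ext_basisTensor fun β h => by
    rw [universalModel_basisTensor, shift_basisTensor, prepend_eq_mulSingle_mul]

variable (n H) in
/-- The adjoints of the operators `shift`. -/
abbrev coshift (α : Words n) : FockTensor n H →L[ℂ] FockTensor n H :=
  ContinuousLinearMap.adjoint (shift n H α)

theorem coshift_apply (α β : Words n) (x : FockTensor n H) :
    (coshift n H α x : FockTensor n H) β = x (α * β) := by
  refine ext_inner_left ℂ fun h => ?_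
  rw [← inner_basisTensor_left, ContinuousLinearMap.adjoint_inner_right, shift_basisTensor,
    inner_basisTensor_left]

theorem coshift_basisTensor_mul (α β : Words n) (h : H) :
    coshift n H α (basisTensor n (α * β) h) = basisTensor n β h := by
  apply lp.ext
  funext γ
  rw [coshift_apply, basisTensor_apply, basisTensor_apply]
  by_cases hγ : γ = β
  · rw [if_pos hγ, if_pos (mul_words_right_inj.2 hγ)]
  · rw [if_neg hγ, if_neg (mt mul_words_right_inj.1 hγ)]

theorem coshift_basisTensor_of_not_exists (α γ : Words n) (h : H) (hγ : ¬ ∃ β, γ = α * β) :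
    coshift n H α (basisTensor n γ h) = 0 := by
  apply lp.ext
  funext β
  rw [coshift_apply, basisTensor_apply, if_neg fun he => hγ ⟨β, he.symm⟩]
  rfl

theorem coshift_mul_shift (α : Words n) : coshift n H α * shift n H α = 1 :=
  clm_ext_basisTensor fun β h => by
    simp [coshift_basisTensor_mul]

theorem coshift_mul (α β : Words n) : coshift n H (α * β) = coshift n H β * coshift n H α := by
  simp only [coshift, map_mul]
  exact ContinuousLinearMap.adjoint_comp _ _

theorem coshift_one : coshift n H 1 = 1 := by
  simp only [coshift, map_one]
  exact ContinuousLinearMap.adjoint_id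

theorem norm_shift_apply (α : Words n) (x : FockTensor n H) : ‖shift n H α x‖ = ‖x‖ := by
  refine (ContinuousLinearMap.norm_map_iff_adjoint_comp_self (shift n H α)).2 ?_ x
  exact coshift_mul_shift α

/-- Comparing lengths forces the remaining suffixes to be empty. Hence, of two distinct tuples, at
least one is not a prefix of the other. -/
theorem eq_of_mul_eq_of_mul_eq {α β γ δ : Words n} (h₁ : β = α * γ) (h₂ : α = β * δ) :
    α = β := by
  funext i
  have e₁ := congrFun h₁ i
  have e₂ := congrFun h₂ i
  rw [Pi.mul_apply] at e₁ e₂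
  have l₁ := congrArg FreeMonoid.length e₁
  have l₂ := congrArg FreeMonoid.length e₂
  rw [FreeMonoid.length_mul] at l₁ l₂
  have : (γ i).length = 0 := by omega
  rw [FreeMonoid.length_eq_zero] at this
  rw [e₁, this, mul_one]

end Shifts

/-! ### Finite sets of words -/

section FiniteWords

/-- Concatenation of a letter and a word, as an embedding. -/
def consWord (m : ℕ) : Fin m × FreeMonoid (Fin m) ↪ FreeMonoid (Fin m) where
  toFun p := FreeMonoid.of p.1 * p.2
  inj' := by
    intro p r hpr
    have := List.cons.inj (congrArg FreeMonoid.toList hpr)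
    exact Prod.ext this.1 (FreeMonoid.toList.injective this.2)

theorem consWord_apply {m : ℕ} (j : Fin m) (w : FreeMonoid (Fin m)) :
    consWord m (j, w) = FreeMonoid.of j * w := rfl

/-- The words of length `s` in `m` letters. -/
def wordsOfLength (m : ℕ) : ℕ → Finset (FreeMonoid (Fin m))
  | 0 => {1}
  | s + 1 => (Finset.univ ×ˢ wordsOfLength m s).map (consWord m)

theorem sum_wordsOfLength_succ {A : Type*} [AddCommMonoid A] (m s : ℕ)
    (f : FreeMonoid (Fin m) → A) :
    ∑ w ∈ wordsOfLength m (s + 1), f w =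
      ∑ j, ∑ w ∈ wordsOfLength m s, f (FreeMonoid.of j * w) := by
  rw [wordsOfLength, Finset.sum_map, Finset.sum_product]
  rfl

theorem mem_wordsOfLength {m s : ℕ} {w : FreeMonoid (Fin m)} :
    w ∈ wordsOfLength m s ↔ w.length = s := by
  induction s generalizing w with
  | zero => simp [wordsOfLength, FreeMonoid.length_eq_zero]
  | succ s ih =>
    simp only [wordsOfLength, Finset.mem_map, Finset.mem_product, Finset.mem_univ, true_and,
      consWord_apply, Prod.exists]
    constructor
    · rintro ⟨j, v, hv, rfl⟩
      rw [FreeMonoid.length_mul, FreeMonoid.length_of, ih.1 hv, add_comm]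
    · induction w using FreeMonoid.casesOn with
      | one => intro h; simp at h
      | of_mul j v =>
        intro h
        rw [FreeMonoid.length_mul, FreeMonoid.length_of] at h
        exact ⟨j, v, ih.2 (by omega), rfl⟩

theorem card_wordsOfLength (m s : ℕ) : (wordsOfLength m s).card = m ^ s := by
  induction s with
  | zero => simp [wordsOfLength]
  | succ s ih => rw [wordsOfLength, Finset.card_map, Finset.card_product, ih]; simp [pow_succ']

theorem pairwiseDisjoint_wordsOfLength (m : ℕ) (s : Set ℕ) :
    s.PairwiseDisjoint (wordsOfLength m) := fun _ _ _ _ hst =>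
  Finset.disjoint_left.2 fun _ h₁ h₂ =>
    hst ((mem_wordsOfLength.1 h₁).symm.trans (mem_wordsOfLength.1 h₂))

/-- The words of length at most `q` in `m` letters. -/
def wordsOfLengthLE (m q : ℕ) : Finset (FreeMonoid (Fin m)) :=
  (Finset.range (q + 1)).disjiUnion (wordsOfLength m) (pairwiseDisjoint_wordsOfLength m _)

theorem mem_wordsOfLengthLE {m q : ℕ} {w : FreeMonoid (Fin m)} :
    w ∈ wordsOfLengthLE m q ↔ w.length ≤ q := by
  simp [wordsOfLengthLE, mem_wordsOfLength]

theorem card_wordsOfLengthLE (m q : ℕ) :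
    (wordsOfLengthLE m q).card = ∑ s ∈ Finset.range (q + 1), m ^ s := by
  simp [wordsOfLengthLE, card_wordsOfLength]

variable {k : ℕ}

/-- The tuples of words whose `i`-th word has length at most `q i`. -/
def wordBox (n q : Fin k → ℕ) : Finset (Words n) :=
  Fintype.piFinset fun i => wordsOfLengthLE (n i) (q i)

theorem mem_wordBox {n q : Fin k → ℕ} {α : Words n} :
    α ∈ wordBox n q ↔ ∀ i, (α i).length ≤ q i := by
  simp [wordBox, mem_wordsOfLengthLE]

theorem card_wordBox (n q : Fin k → ℕ) :
    (wordBox n q).card = ∏ i, ∑ s ∈ Finset.range (q i + 1), n i ^ s := by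
  simp [wordBox, card_wordsOfLengthLE]

end FiniteWords

/-! ### Reconstruction of an operator from its defect on basis vectors -/

section Reconstruction

variable {k : ℕ} {n : Fin k → ℕ} {H : Type*} [NormedAddCommGroup H] [InnerProductSpace ℂ H]
  [CompleteSpace H]

variable (n H) in
/-- The maps `Y ↦ S_α Y S_α^*`. -/
def shiftConj : Words n →* Module.End ℂ (FockTensor n H →L[ℂ] FockTensor n H) where
  toFun α :=
    { toFun Y := shift n H α * Y * coshift n H α
      map_add' Y Z := by rw [mul_add, add_mul]
      map_smul' c Y := by rw [mul_smul_comm, smul_mul_assoc]; rfl }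
  map_one' := by
    ext1 Y
    change shift n H 1 * Y * coshift n H 1 = Y
    rw [map_one, coshift_one, one_mul, mul_one]
  map_mul' α β := by
    ext1 Y
    change shift n H (α * β) * Y * coshift n H (α * β) =
      shift n H α * (shift n H β * Y * coshift n H β) * coshift n H α
    rw [map_mul, coshift_mul]
    simp only [mul_assoc]

theorem shiftConj_apply (α : Words n) (Y : FockTensor n H →L[ℂ] FockTensor n H) :
    shiftConj n H α Y = shift n H α * Y * coshift n H α := rfl

theorem cpMap_universalModel (i : Fin k) :
    cpMap (universalModel n H i) =
      ∑ j, shiftConj n H (Pi.mulSingle i (FreeMonoid.of j)) := by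
  ext1 Y
  rw [LinearMap.sum_apply]
  change ∑ j : Fin (n i), universalModel n H i j ∘L Y ∘L
    ContinuousLinearMap.adjoint (universalModel n H i j) = _
  refine Finset.sum_congr rfl fun j _ => ?_
  rw [shiftConj_apply, universalModel_eq_shift, mul_assoc]
  rfl

theorem cpMap_universalModel_pow (i : Fin k) (s : ℕ) :
    cpMap (universalModel n H i) ^ s =
      ∑ w ∈ wordsOfLength (n i) s, shiftConj n H (Pi.mulSingle i w) := by
  induction s with
  | zero => simp [wordsOfLength]
  | succ s ih =>
    rw [pow_succ', ih, sum_wordsOfLength_succ, cpMap_universalModel, Finset.sum_mul_sum]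
    simp only [← map_mul, ← Pi.mulSingle_mul]

/-- The partial sums `∑_{s ≤ q} Φ_{S_i}^s`. -/
def cpSum (n : Fin k → ℕ) (H : Type*) [NormedAddCommGroup H] [InnerProductSpace ℂ H]
    [CompleteSpace H] (q : ℕ) (i : Fin k) :
    Module.End ℂ (FockTensor n H →L[ℂ] FockTensor n H) :=
  ∑ s ∈ Finset.range (q + 1), cpMap (universalModel n H i) ^ s

theorem cpSum_eq (q : ℕ) (i : Fin k) :
    cpSum n H q i = ∑ w ∈ wordsOfLengthLE (n i) q, shiftConj n H (Pi.mulSingle i w) := by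
  rw [wordsOfLengthLE, Finset.sum_disjiUnion]
  exact Finset.sum_congr rfl fun s _ => cpMap_universalModel_pow i s

/-- The operators that vanish on the basis vectors `e_γ ⊗ h` with `|γ_i| ≤ q_i`. -/
def vanishing (n : Fin k → ℕ) (H : Type*) [NormedAddCommGroup H] [InnerProductSpace ℂ H]
    [CompleteSpace H] (q : Fin k → ℕ) :
    Submodule ℂ (FockTensor n H →L[ℂ] FockTensor n H) where
  carrier := {Y | ∀ γ ∈ wordBox n q, ∀ h, Y (basisTensor n γ h) = 0}
  add_mem' hY hZ γ hγ h := by simp [hY γ hγ h, hZ γ hγ h]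
  zero_mem' := by simp
  smul_mem' c Y hY γ hγ h := by simp [hY γ hγ h]

/-- The box is closed under removing prefixes, and `S_α^*` either kills a basis vector or removes
the prefix `α`. -/
theorem shiftConj_mem_vanishing (q : Fin k → ℕ) (α : Words n)
    {Y : FockTensor n H →L[ℂ] FockTensor n H} (hY : Y ∈ vanishing n H q) :
    shiftConj n H α Y ∈ vanishing n H q := by
  intro γ hγ h
  rw [shiftConj_apply, mul_apply_eq_comp, mul_apply_eq_comp]
  by_cases hα : ∃ β, γ = α * β
  · obtain ⟨β, rfl⟩ := hα
    rw [coshift_basisTensor_mul, hY, map_zero]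
    rw [mem_wordBox] at hγ ⊢
    intro i
    have := hγ i
    rw [Pi.mul_apply, FreeMonoid.length_mul] at this
    omega
  · rw [coshift_basisTensor_of_not_exists α γ h hα, map_zero, map_zero]

theorem coshift_basisTensor_of_notMem_wordBox {q : Fin k → ℕ} {α γ : Words n}
    (hα : α ∉ wordBox n q) (hγ : γ ∈ wordBox n q) (h : H) :
    coshift n H α (basisTensor n γ h) = 0 := by
  refine coshift_basisTensor_of_not_exists α γ h ?_
  rintro ⟨β, rfl⟩
  refine hα (mem_wordBox.2 fun i => ?_)
  have := mem_wordBox.1 hγ i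
  rw [Pi.mul_apply, FreeMonoid.length_mul] at this
  omega

theorem cpSum_mem_vanishing (q : Fin k → ℕ) (i : Fin k)
    {Y : FockTensor n H →L[ℂ] FockTensor n H} (hY : Y ∈ vanishing n H q) :
    cpSum n H (q i) i Y ∈ vanishing n H q := by
  rw [cpSum_eq, LinearMap.sum_apply]
  exact Submodule.sum_mem _ fun w _ => shiftConj_mem_vanishing q _ hY

/-- Every word of length `q i + 1` is too long to be a prefix of the `i`-th word in the box, so each
term of the remainder kills the box. -/
theorem cpMap_pow_mem_vanishing (q : Fin k → ℕ) (i : Fin k)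
    (Y : FockTensor n H →L[ℂ] FockTensor n H) :
    (cpMap (universalModel n H i) ^ (q i + 1)) Y ∈ vanishing n H q := by
  rw [cpMap_universalModel_pow, LinearMap.sum_apply]
  refine Submodule.sum_mem _ fun w hw γ hγ h => ?_
  rw [shiftConj_apply, mul_apply_eq_comp, mul_apply_eq_comp,
    coshift_basisTensor_of_notMem_wordBox _ hγ, map_zero, map_zero]
  intro hmem
  have h₁ := mem_wordBox.1 hmem i
  rw [Pi.mulSingle_eq_same, mem_wordsOfLength.1 hw] at h₁
  omega

theorem prod_cpSum_mem_vanishing (q : Fin k → ℕ) (L : List (Fin k))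
    {Y : FockTensor n H →L[ℂ] FockTensor n H} (hY : Y ∈ vanishing n H q) :
    (L.map fun i => cpSum n H (q i) i).prod Y ∈ vanishing n H q := by
  induction L with
  | nil => simpa
  | cons a L ih =>
    rw [List.map_cons, List.prod_cons]
    exact cpSum_mem_vanishing q a ih

/-- Each factor telescopes as a geometric sum, with an error in `vanishing`, which the remaining
partial sums preserve. The reversed order puts each partial sum next to the factor it inverts, so no
commutation between coordinates is needed. -/
theorem cpSum_reconstruct (q : Fin k → ℕ) (L : List (Fin k))
    (Y : FockTensor n H →L[ℂ] FockTensor n H) :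
    (L.reverse.map fun i => cpSum n H (q i) i).prod
      ((L.map fun i => 1 - cpMap (universalModel n H i)).prod Y) - Y ∈ vanishing n H q := by
  induction L with
  | nil => simp
  | cons a L ih =>
    set Z := (L.map fun i => 1 - cpMap (universalModel n H i)).prod Y with hZ
    set R := (L.reverse.map fun i => cpSum n H (q i) i).prod with hR
    have h₁ : (((a :: L).map fun i => 1 - cpMap (universalModel n H i)).prod) Y =
        (1 - cpMap (universalModel n H a)) Z := by
      rw [List.map_cons, List.prod_cons]; rfl
    have h₂ : ((a :: L).reverse.map fun i => cpSum n H (q i) i).prod =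
        R * cpSum n H (q a) a := by
      simp [hR]
    have h₃ : cpSum n H (q a) a ((1 - cpMap (universalModel n H a)) Z) =
        Z - (cpMap (universalModel n H a) ^ (q a + 1)) Z := by
      have := geom_sum_mul_neg (cpMap (universalModel n H a)) (q a + 1)
      exact LinearMap.congr_fun this Z
    rw [h₁, h₂, Module.End.mul_apply, h₃, map_sub]
    have h₄ := prod_cpSum_mem_vanishing q L.reverse (cpMap_pow_mem_vanishing q a Z)
    have h₅ := Submodule.sub_mem _ ih h₄
    rw [sub_right_comm] at h₅
    exact h₅

theorem prod_cpSum_eq (q : Fin k → ℕ) (L : List (Fin k)) (hL : L.Nodup) :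
    (L.map fun i => cpSum n H (q i) i).prod =
      ∑ α ∈ Fintype.piFinset fun i => if i ∈ L then wordsOfLengthLE (n i) (q i) else {1},
        shiftConj n H α := by
  induction L with
  | nil =>
    simp only [List.map_nil, List.prod_nil, List.not_mem_nil, if_false,
      Fintype.piFinset_singleton, Finset.sum_singleton]
    exact (map_one _).symm
  | cons a L ih =>
    rw [List.nodup_cons] at hL
    rw [List.map_cons, List.prod_cons, ih hL.2, cpSum_eq, Finset.sum_mul_sum,
      ← Finset.sum_product']
    -- The tail `α` has trivial `a`-th word because `a ∉ L`, so a pair is recovered from its product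
    -- by splitting off coordinate `a`.
    refine Finset.sum_bij (fun p _ => Pi.mulSingle a p.1 * p.2) ?_ ?_ ?_ ?_
    · rintro ⟨w, α⟩ hp
      simp only [Finset.mem_product, Fintype.mem_piFinset] at hp ⊢
      intro i
      by_cases hi : i = a
      · subst hi
        have := hp.2 i
        rw [if_neg hL.1, Finset.mem_singleton] at this
        simp [this, hp.1]
      · simpa [hi] using hp.2 i
    · rintro ⟨w, α⟩ hp ⟨w', α'⟩ hp' he
      simp only [Finset.mem_product, Fintype.mem_piFinset] at hp hp' he
      have e₁ := hp.2 a
      have e₂ := hp'.2 a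
      rw [if_neg hL.1, Finset.mem_singleton] at e₁ e₂
      refine Prod.ext ?_ (funext fun i => ?_)
      · simpa [e₁, e₂] using congrFun he a
      · by_cases hi : i = a
        · subst hi; exact e₁.trans e₂.symm
        · simpa [hi] using congrFun he i
    · intro α hα
      rw [Fintype.mem_piFinset] at hα
      refine ⟨(α a, Function.update α a 1), ?_, ?_⟩
      · simp only [Finset.mem_product, Fintype.mem_piFinset]
        refine ⟨by simpa using hα a, fun i => ?_⟩
        by_cases hi : i = a
        · subst hi; simp [hL.1]
        · simpa [hi] using hα i
      · funext i
        by_cases hi : i = a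
        · subst hi; simp
        · simp [hi]
    · rintro ⟨w, α⟩ _
      exact (map_mul _ _ _).symm

/-- On basis vectors in the box `q`, an operator is the sum over the box of the conjugates of its
defect. -/
theorem sum_shiftConj_defectMap (q : Fin k → ℕ) (Y : FockTensor n H →L[ℂ] FockTensor n H)
    {γ : Words n} (hγ : γ ∈ wordBox n q) (h : H) :
    ∑ α ∈ wordBox n q, shift n H α (defectMap (universalModel n H) Y
      (coshift n H α (basisTensor n γ h))) = Y (basisTensor n γ h) := by
  have h₁ := cpSum_reconstruct q (List.finRange k) Y γ hγ h
  rw [prod_cpSum_eq q _ (List.nodup_reverse.2 (List.nodup_finRange k))] at h₁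
  simp only [List.mem_reverse, List.mem_finRange, if_true] at h₁
  rw [sub_apply, sub_eq_zero, LinearMap.sum_apply,
    sum_apply, ← List.ofFn_eq_map] at h₁
  exact h₁

end Reconstruction

/-! ### Factorization of an operator with positive defect -/

section Factorization

variable {k : ℕ} {n : Fin k → ℕ} {H : Type*} [NormedAddCommGroup H] [InnerProductSpace ℂ H]
  [CompleteSpace H]

theorem exists_subset_wordBox (F : Finset (Words n)) : ∃ q, F ⊆ wordBox n q :=
  ⟨fun i => F.sup fun γ => (γ i).length, fun _ hγ => mem_wordBox.2 fun i =>
    Finset.le_sup (f := fun γ : Words n => (γ i).length) hγ⟩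

theorem norm_sq_eq_re_inner_of_eq_adjoint_comp {A B : FockTensor n H →L[ℂ] FockTensor n H}
    (hAB : A = ContinuousLinearMap.adjoint B ∘L B) (x : FockTensor n H) :
    ‖B x‖ ^ 2 = (inner ℂ (A x) x).re := by
  rw [ContinuousLinearMap.apply_norm_sq_eq_inner_adjoint_left, hAB]
  rfl

/-- For a finitely supported vector `y`, the sum of these terms over a box large enough to contain
both `F` and `F'` is exactly `Re ⟨Y y, y⟩`. -/
theorem sum_norm_sq_le_of_mem_box {Y B : FockTensor n H →L[ℂ] FockTensor n H}
    (hB : defectMap (universalModel n H) Y = ContinuousLinearMap.adjoint B ∘L B)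
    (F F' : Finset (Words n)) (x : FockTensor n H) :
    ∑ α ∈ F', ‖B (coshift n H α (∑ γ ∈ F, basisTensor n γ (x γ)))‖ ^ 2 ≤
      ‖Y‖ * ‖∑ γ ∈ F, basisTensor n γ (x γ)‖ ^ 2 := by
  classical
  obtain ⟨q, hq⟩ := exists_subset_wordBox (F ∪ F')
  set y := ∑ γ ∈ F, basisTensor n γ (x γ) with hy
  have hYy : Y y = ∑ α ∈ wordBox n q, shift n H α (defectMap (universalModel n H) Y
      (coshift n H α y)) := by
    simp only [hy, map_sum]
    rw [Finset.sum_comm]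
    exact Finset.sum_congr rfl fun γ hγ =>
      (sum_shiftConj_defectMap q Y (hq (Finset.mem_union_left _ hγ)) _).symm
  calc
    _ ≤ ∑ α ∈ wordBox n q, ‖B (coshift n H α y)‖ ^ 2 :=
      Finset.sum_le_sum_of_subset_of_nonneg (Finset.union_subset_right hq)
        fun _ _ _ => sq_nonneg _
    _ = (inner ℂ (Y y) y).re := by
      rw [hYy, sum_inner, Complex.re_sum]
      refine Finset.sum_congr rfl fun α _ => ?_
      rw [norm_sq_eq_re_inner_of_eq_adjoint_comp hB, ContinuousLinearMap.adjoint_inner_right]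
    _ ≤ ‖Y y‖ * ‖y‖ := (Complex.re_le_norm _).trans (norm_inner_le_norm _ _)
    _ ≤ ‖Y‖ * ‖y‖ ^ 2 := by
      rw [pow_two, ← mul_assoc]
      gcongr
      exact Y.le_opNorm y

theorem sum_norm_sq_le {Y B : FockTensor n H →L[ℂ] FockTensor n H}
    (hB : defectMap (universalModel n H) Y = ContinuousLinearMap.adjoint B ∘L B)
    (F' : Finset (Words n)) (x : FockTensor n H) :
    ∑ α ∈ F', ‖B (coshift n H α x)‖ ^ 2 ≤ ‖Y‖ * ‖x‖ ^ 2 := by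
  have hx : Tendsto (fun F : Finset (Words n) => ∑ γ ∈ F, basisTensor n γ (x γ)) atTop (𝓝 x) :=
    hasSum_basisTensor x
  have h₁ : Continuous fun y : FockTensor n H => ∑ α ∈ F', ‖B (coshift n H α y)‖ ^ 2 := by
    fun_prop
  have h₂ : Continuous fun y : FockTensor n H => ‖Y‖ * ‖y‖ ^ 2 := by fun_prop
  exact le_of_tendsto_of_tendsto' ((h₁.tendsto x).comp hx) ((h₂.tendsto x).comp hx)
    fun F => sum_norm_sq_le_of_mem_box hB F F' x

/-- If the defect of `Y` is `B^* B`, then `Y = C^* C` for the operator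
`C x = (B S_α^* x)_α`. -/
theorem exists_factorization {Y B : FockTensor n H →L[ℂ] FockTensor n H}
    (hB : defectMap (universalModel n H) Y = ContinuousLinearMap.adjoint B ∘L B) :
    ∃ C : FockTensor n H →L[ℂ] lp (fun _ : Words n => FockTensor n H) 2,
      (∀ x α, C x α = B (coshift n H α x)) ∧ ContinuousLinearMap.adjoint C ∘L C = Y := by
  have hmem : ∀ x, Memℓp (fun α : Words n => B (coshift n H α x)) 2 := fun x =>
    memℓp_gen' (C := ‖Y‖ * ‖x‖ ^ 2) fun s => by
      simpa using sum_norm_sq_le hB s x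
  let C₀ : FockTensor n H →ₗ[ℂ] lp (fun _ : Words n => FockTensor n H) 2 :=
    { toFun x := ⟨fun α => B (coshift n H α x), hmem x⟩
      map_add' x y := by
        apply lp.ext; funext α; simp; rfl
      map_smul' c x := by
        apply lp.ext; funext α; simp }
  have hbound : ∀ x, ‖C₀ x‖ ≤ √‖Y‖ * ‖x‖ := fun x => by
    refine lp.norm_le_of_forall_sum_le (by norm_num) (by positivity) fun s => ?_
    have := sum_norm_sq_le hB s x
    simpa [mul_pow, C₀] using this
  refine ⟨C₀.mkContinuous _ hbound, fun x α => rfl, clm_ext_basisTensor fun γ h => ?_⟩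
  set C := C₀.mkContinuous _ hbound
  refine ext_inner_right ℂ fun y => ?_
  rw [ContinuousLinearMap.comp_apply, ContinuousLinearMap.adjoint_inner_left]
  obtain ⟨q, hq⟩ := exists_subset_wordBox {γ}
  have hγ : γ ∈ wordBox n q := hq (Finset.mem_singleton_self γ)
  have h₁ := lp.hasSum_inner (𝕜 := ℂ) (C (basisTensor n γ h)) (C y)
  -- Against a basis vector only finitely many coordinates of `C` survive, which reduces the
  -- identity to the finite reconstruction formula.
  have h₂ : HasSum (fun α => inner ℂ (C (basisTensor n γ h) α) (C y α))
      (∑ α ∈ wordBox n q, inner ℂ (C (basisTensor n γ h) α) (C y α)) := by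
    refine hasSum_sum_of_ne_finset_zero fun α hα => ?_
    change inner ℂ (B (coshift n H α (basisTensor n γ h))) (B (coshift n H α y)) = 0
    rw [coshift_basisTensor_of_notMem_wordBox hα hγ, map_zero, inner_zero_left]
  rw [h₁.unique h₂, ← sum_shiftConj_defectMap q Y hγ h, sum_inner]
  refine Finset.sum_congr rfl fun α _ => ?_
  change inner ℂ (B (coshift n H α (basisTensor n γ h))) (B (coshift n H α y)) = _
  rw [hB, ContinuousLinearMap.comp_apply,
    ← ContinuousLinearMap.adjoint_inner_right (shift n H α),
    ContinuousLinearMap.adjoint_inner_left B]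

/-- The nonnegative terms along `g` already exhaust the total, so nothing is left for an index
outside the range of `g`. -/
theorem eq_zero_of_hasSum_comp_injective {ι κ : Type*} {f : κ → ℝ} {g : ι → κ} {a : ℝ}
    (hf₀ : ∀ b, 0 ≤ f b) (hg : Function.Injective g) (hf : HasSum f a)
    (hfg : HasSum (fun i => f (g i)) a) {b : κ} (hb : ∀ i, g i ≠ b) : f b = 0 := by
  classical
  have h : a ≤ a - f b := hasSum_le_of_sum_le hfg fun s => by
    have h₁ := sum_le_hasSum (insert b (s.image g)) (fun i _ => hf₀ i) hf
    rw [Finset.sum_insert (by simpa using fun i _ => hb i),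
      Finset.sum_image fun _ _ _ _ h => hg h] at h₁
    linarith
  linarith [hf₀ b]

end Factorization

/-! ### Intertwiners and defects -/

section WordOp

variable {X Y : Type*} [NormedAddCommGroup X] [InnerProductSpace ℂ X]
  [NormedAddCommGroup Y] [InnerProductSpace ℂ Y]
  {k : ℕ} {n : Fin k → ℕ} {T : OpTuple n X} {T' : OpTuple n Y} {V : X →L[ℂ] Y}

theorem wordOp_intertwine (hV : ∀ i j, V ∘L T i j = T' i j ∘L V) (α : Words n) (x : X) :
    V (wordOp T α x) = wordOp T' α (V x) := by
  have h₁ : ∀ i (w : FreeMonoid (Fin (n i))) x,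
      V (FreeMonoid.lift (T i) w x) = FreeMonoid.lift (T' i) w (V x) := by
    intro i w
    induction w using FreeMonoid.inductionOn' with
    | one => simp
    | of_mul j w ih =>
      intro x
      rw [map_mul, map_mul, mul_apply_eq_comp, mul_apply_eq_comp, ← ih]
      exact DFunLike.congr_fun (hV i j) _
  rw [wordOp, wordOp, List.ofFn_eq_map, List.ofFn_eq_map]
  induction List.finRange k with
  | nil => rfl
  | cons a L ih =>
    rw [List.map_cons, List.prod_cons, List.map_cons, List.prod_cons, mul_apply_eq_comp,
      mul_apply_eq_comp, ← ih, h₁]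

/-- This transfers what is known about word operators back to the generators. -/
theorem wordOp_mulSingle_of (T : OpTuple n X) (i : Fin k) (j : Fin (n i)) :
    wordOp T (Pi.mulSingle i (FreeMonoid.of j)) = T i j := by
  have key : ∀ L : List (Fin k), L.Nodup →
      (L.map fun a => FreeMonoid.lift (T a)
        ((Pi.mulSingle i (FreeMonoid.of j) : Words n) a)).prod = if i ∈ L then T i j else 1 := by
    intro L
    induction L with
    | nil => simp
    | cons a L ih =>
      intro hL
      rw [List.nodup_cons] at hL
      rw [List.map_cons, List.prod_cons, ih hL.2]
      by_cases hi : a = i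
      · subst hi; simp [hL.1]
      · simp [Ne.symm hi, hi]
  rw [wordOp, List.ofFn_eq_map, key _ (List.nodup_finRange k), if_pos (List.mem_finRange i)]

end WordOp

section Intertwining

variable {X Y : Type*} [NormedAddCommGroup X] [InnerProductSpace ℂ X] [CompleteSpace X]
  [NormedAddCommGroup Y] [InnerProductSpace ℂ Y] [CompleteSpace Y]
  {k : ℕ} {n : Fin k → ℕ} {T : OpTuple n X} {T' : OpTuple n Y} {V : X →L[ℂ] Y}

theorem cpMap_conj (hV : ∀ i j, V ∘L T i j = T' i j ∘L V) (i : Fin k) (Z : X →L[ℂ] X) :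
    cpMap (T' i) (V ∘L Z ∘L ContinuousLinearMap.adjoint V) =
      V ∘L cpMap (T i) Z ∘L ContinuousLinearMap.adjoint V := by
  change ∑ j : Fin (n i), T' i j ∘L (V ∘L Z ∘L ContinuousLinearMap.adjoint V) ∘L
      ContinuousLinearMap.adjoint (T' i j) =
    V ∘L (∑ j : Fin (n i), T i j ∘L Z ∘L ContinuousLinearMap.adjoint (T i j)) ∘L
      ContinuousLinearMap.adjoint V
  rw [ContinuousLinearMap.finsetSum_comp, ContinuousLinearMap.comp_finsetSum]
  refine Finset.sum_congr rfl fun j _ => ?_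
  have h := congrArg ContinuousLinearMap.adjoint (hV i j)
  rw [ContinuousLinearMap.adjoint_comp, ContinuousLinearMap.adjoint_comp] at h
  calc _ = (T' i j ∘L V) ∘L Z ∘L
        (ContinuousLinearMap.adjoint V ∘L ContinuousLinearMap.adjoint (T' i j)) := rfl
    _ = _ := by rw [← h, ← hV]; rfl

/-- Used twice with `Z = id`: for the inclusion of `M`, where `V V^* = P_M`, and for a unitary,
where `V V^* = id`. -/
theorem defectMap_conj (hV : ∀ i j, V ∘L T i j = T' i j ∘L V) (Z : X →L[ℂ] X) :
    defectMap T' (V ∘L Z ∘L ContinuousLinearMap.adjoint V) =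
      V ∘L defectMap T Z ∘L ContinuousLinearMap.adjoint V := by
  rw [defectMap, defectMap, List.ofFn_eq_map, List.ofFn_eq_map]
  induction List.finRange k with
  | nil => rfl
  | cons a L ih =>
    rw [List.map_cons, List.prod_cons, List.map_cons, List.prod_cons, Module.End.mul_apply,
      Module.End.mul_apply, ih, LinearMap.sub_apply, LinearMap.sub_apply, cpMap_conj hV]
    simp [ContinuousLinearMap.sub_comp, ContinuousLinearMap.comp_sub]

theorem UnitarilyEquivalent.tupleRank_eq (h : UnitarilyEquivalent T T') :
    tupleRank T = tupleRank T' := by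
  obtain ⟨U, hU⟩ := h
  have hV : ∀ i j, (U.toContinuousLinearEquiv : X →L[ℂ] Y) ∘L T i j =
      T' i j ∘L (U.toContinuousLinearEquiv : X →L[ℂ] Y) := fun i j => by
    ext x; exact hU i j x
  have h₁ := defectMap_conj hV (ContinuousLinearMap.id ℂ X)
  have h₂ : ContinuousLinearMap.adjoint (U.toContinuousLinearEquiv : X →L[ℂ] Y) =
      (U.symm.toContinuousLinearEquiv : Y →L[ℂ] X) := U.adjoint_eq_symm
  have h₃ : ∀ y, defect T' y = U (defect T (U.symm y)) := by
    intro y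
    rw [h₂] at h₁
    have h₄ : (U.toContinuousLinearEquiv : X →L[ℂ] Y) ∘L ContinuousLinearMap.id ℂ X ∘L
        (U.symm.toContinuousLinearEquiv : Y →L[ℂ] X) = ContinuousLinearMap.id ℂ Y := by
      ext y; simp
    rw [h₄] at h₁
    exact DFunLike.congr_fun h₁ y
  have h₅ : (defect T' : Y →ₗ[ℂ] Y).range =
      (defect T : X →ₗ[ℂ] X).range.map (U.toLinearEquiv : X →ₗ[ℂ] Y) := by
    ext y
    constructor
    · rintro ⟨z, rfl⟩
      exact ⟨_, ⟨U.symm z, rfl⟩, (h₃ z).symm⟩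
    · rintro ⟨_, ⟨x, rfl⟩, rfl⟩
      refine ⟨U x, (h₃ _).trans ?_⟩
      simp
  rw [tupleRank, tupleRank, h₅]
  exact (LinearEquiv.finrank_map_eq U.toLinearEquiv _).symm

end Intertwining

/-! ### The restricted model has a wandering basis -/

section Restriction

variable {k : ℕ} {n : Fin k → ℕ} {H : Type*} [NormedAddCommGroup H] [InnerProductSpace ℂ H]
  [CompleteSpace H] {M : Submodule ℂ (FockTensor n H)}

theorem subtypeL_restrictedModel (hM : IsInvariant (universalModel n H) M) (i : Fin k)
    (j : Fin (n i)) :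
    M.subtypeL ∘L restrictedModel hM i j = universalModel n H i j ∘L M.subtypeL := rfl

theorem coe_wordOp_restrictedModel (hM : IsInvariant (universalModel n H) M) (α : Words n)
    (x : M) : (wordOp (restrictedModel hM) α x : FockTensor n H) = shift n H α x :=
  wordOp_intertwine (subtypeL_restrictedModel hM) α x

variable [CompleteSpace M]

theorem subspaceDefect_eq (hM : IsInvariant (universalModel n H) M) :
    subspaceDefect n H M = M.subtypeL ∘L defect (restrictedModel hM) ∘L
      ContinuousLinearMap.adjoint M.subtypeL := by
  have h := defectMap_conj (subtypeL_restrictedModel hM) (ContinuousLinearMap.id ℂ M)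
  rw [ContinuousLinearMap.id_comp] at h
  rw [subspaceDefect, defect, ← h, Submodule.adjoint_subtypeL]
  rfl

theorem subspaceDefect_coe (hM : IsInvariant (universalModel n H) M) (x : M) :
    subspaceDefect n H M x = defect (restrictedModel hM) x := by
  rw [subspaceDefect_eq hM, Submodule.adjoint_subtypeL]
  simp

theorem range_subspaceDefect (hM : IsInvariant (universalModel n H) M) :
    (subspaceDefect n H M : FockTensor n H →ₗ[ℂ] FockTensor n H).range =
      (defect (restrictedModel hM) : M →ₗ[ℂ] M).range.map M.subtype := by
  ext y
  constructor
  · rintro ⟨z, rfl⟩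
    refine ⟨_, ⟨ContinuousLinearMap.adjoint M.subtypeL z, rfl⟩, ?_⟩
    change _ = subspaceDefect n H M z
    rw [subspaceDefect_eq hM]
    rfl
  · rintro ⟨_, ⟨x, rfl⟩, rfl⟩
    exact ⟨x, subspaceDefect_coe hM x⟩

theorem isFiniteRank_defect (hM : IsInvariant (universalModel n H) M)
    (hfin : IsFiniteRank (subspaceDefect n H M)) :
    IsFiniteRank (defect (restrictedModel hM)) := by
  rw [IsFiniteRank, range_subspaceDefect hM] at hfin
  exact LinearEquiv.finiteDimensional (Submodule.equivMapOfInjective M.subtype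
    M.injective_subtype _).symm

theorem subspaceDefect_apply_mem (hM : IsInvariant (universalModel n H) M)
    (x : FockTensor n H) : subspaceDefect n H M x ∈ M := by
  rw [subspaceDefect_eq hM]
  exact Subtype.property _

theorem exists_adjoint_comp_eq {X : Type*} [NormedAddCommGroup X] [InnerProductSpace ℂ X]
    [CompleteSpace X] {A : X →L[ℂ] X} (hA : A.IsPositive) :
    ∃ B : X →L[ℂ] X, A = ContinuousLinearMap.adjoint B ∘L B :=
  CStarAlgebra.nonneg_iff_eq_star_mul_self.1 ((ContinuousLinearMap.nonneg_iff_isPositive A).2 hA)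

end Restriction

/-! ### Orthogonality and completeness of the translates of the defect space -/

section Wandering

variable {k : ℕ} {n : Fin k → ℕ} {H : Type*} [NormedAddCommGroup H] [InnerProductSpace ℂ H]
  [CompleteSpace H] {M : Submodule ℂ (FockTensor n H)}

theorem shift_mem (hM : IsInvariant (universalModel n H) M) (α : Words n) {x : FockTensor n H}
    (hx : x ∈ M) : shift n H α x ∈ M := by
  rw [← coe_wordOp_restrictedModel hM α ⟨x, hx⟩]
  exact Subtype.property _

variable [CompleteSpace M]

section Factor

variable {B : FockTensor n H →L[ℂ] FockTensor n H}
  (hB : subspaceDefect n H M = ContinuousLinearMap.adjoint B ∘L B)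

include hB

theorem subspaceDefect_apply_eq_zero_iff (x : FockTensor n H) :
    subspaceDefect n H M x = 0 ↔ B x = 0 := by
  constructor
  · intro h
    have := norm_sq_eq_re_inner_of_eq_adjoint_comp hB x
    rw [h, inner_zero_left, Complex.zero_re] at this
    exact norm_eq_zero.1 (pow_eq_zero_iff two_ne_zero |>.1 this)
  · intro h
    rw [hB, ContinuousLinearMap.comp_apply, h, map_zero]

/-- This is `⟨C x, C y⟩ = ⟨P_M x, y⟩` for the factorization `P_M = C^* C`. Only `x` has to lie in
`M`. -/
theorem hasSum_inner_coshift {x : FockTensor n H} (hx : x ∈ M) (y : FockTensor n H) :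
    HasSum (fun α => inner ℂ (subspaceDefect n H M (coshift n H α x)) (coshift n H α y))
      (inner ℂ x y) := by
  obtain ⟨C, hC, hCP⟩ := exists_factorization (Y := M.starProjection) hB
  have h := lp.hasSum_inner (𝕜 := ℂ) (C x) (C y)
  rw [← ContinuousLinearMap.adjoint_inner_left, ← ContinuousLinearMap.comp_apply, hCP,
    Submodule.starProjection_eq_self_iff.2 hx] at h
  simp only [hC] at h
  simpa only [hB, ContinuousLinearMap.comp_apply, ContinuousLinearMap.adjoint_inner_left] using h

theorem hasSum_norm_sq_coshift {x : FockTensor n H} (hx : x ∈ M) :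
    HasSum (fun α => ‖B (coshift n H α x)‖ ^ 2) (‖x‖ ^ 2) := by
  have h := Complex.hasSum_re (hasSum_inner_coshift hB hx x)
  simp only [← norm_sq_eq_re_inner_of_eq_adjoint_comp hB] at h
  convert h
  rw [inner_self_eq_norm_sq_to_K]
  norm_cast

/-- Since `S_{αγ}^* S_α = S_γ^*`, the terms indexed by `αγ` in the norm identity for `S_α x` sum to
`‖x‖² = ‖S_α x‖²`; the term at `β` is therefore zero. -/
theorem subspaceDefect_coshift_shift_of_not_exists (hM : IsInvariant (universalModel n H) M)
    {α β : Words n} (hβ : ¬ ∃ γ, β = α * γ) {x : FockTensor n H} (hx : x ∈ M) :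
    subspaceDefect n H M (coshift n H β (shift n H α x)) = 0 := by
  rw [subspaceDefect_apply_eq_zero_iff hB]
  have h₁ := hasSum_norm_sq_coshift hB (shift_mem hM α hx)
  rw [norm_shift_apply] at h₁
  have h₂ : ∀ γ, coshift n H (α * γ) (shift n H α x) = coshift n H γ x := fun γ => by
    rw [coshift_mul, mul_apply_eq_comp, ← mul_apply_eq_comp (coshift n H α),
      coshift_mul_shift]
    rfl
  have h₃ := eq_zero_of_hasSum_comp_injective (g := fun γ : Words n => α * γ) (b := β)
    (fun _ => sq_nonneg _) (fun γ δ h => mul_words_right_inj.1 h) h₁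
    (by simpa only [h₂] using hasSum_norm_sq_coshift hB hx) fun γ h => hβ ⟨γ, h.symm⟩
  exact norm_eq_zero.1 (pow_eq_zero_iff two_ne_zero |>.1 h₃)

end Factor

variable (hM : IsInvariant (universalModel n H) M) (hpos : (subspaceDefect n H M).IsPositive)

include hM hpos

/-- Moving `S_β` and the second defect to the left side gives `Δ S_β^* S_α Δ x`, which vanishes
unless `α` is a prefix of `β`. In that case the roles are exchanged. -/
theorem inner_shift_subspaceDefect {α β : Words n} (hαβ : α ≠ β) (x y : FockTensor n H) :
    inner ℂ (shift n H α (subspaceDefect n H M x)) (shift n H β (subspaceDefect n H M y)) = 0 := by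
  obtain ⟨B, hB⟩ := exists_adjoint_comp_eq hpos
  have key : ∀ {α β : Words n} (x y : FockTensor n H), (¬ ∃ γ, β = α * γ) →
      inner ℂ (shift n H α (subspaceDefect n H M x))
        (shift n H β (subspaceDefect n H M y)) = 0 := by
    intro α β x y h
    have h₁ := subspaceDefect_coshift_shift_of_not_exists hB hM h
      (subspaceDefect_apply_mem hM x)
    rw [← ContinuousLinearMap.adjoint_inner_left, ← hpos.isSelfAdjoint.adjoint_eq,
      ContinuousLinearMap.adjoint_inner_right, hpos.isSelfAdjoint.adjoint_eq, h₁,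
      inner_zero_left]
  by_cases h₁ : ∃ γ, β = α * γ
  · by_cases h₂ : ∃ δ, α = β * δ
    · exact absurd (eq_of_mul_eq_of_mul_eq h₁.choose_spec h₂.choose_spec) hαβ
    · rw [← inner_conj_symm, key y x h₂, map_zero]
  · exact key x y h₁

/-- Expand `⟨Δ x, y⟩` by `hasSum_inner_coshift`: orthogonality to the translates kills every term
with `α ≠ 1`, and the remaining one is `⟨Δ Δ x, y⟩`. -/
theorem subspaceDefect_idem (x : FockTensor n H) :
    subspaceDefect n H M (subspaceDefect n H M x) = subspaceDefect n H M x := by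
  obtain ⟨B, hB⟩ := exists_adjoint_comp_eq hpos
  refine ext_inner_right ℂ fun y => ?_
  have h₁ := hasSum_inner_coshift hB (subspaceDefect_apply_mem hM x) y
  have h₂ : ∀ α : Words n, α ≠ 1 →
      subspaceDefect n H M (coshift n H α (subspaceDefect n H M x)) = 0 := by
    intro α hα
    refine ext_inner_right ℂ fun z => ?_
    have := inner_shift_subspaceDefect hM hpos hα.symm x z
    rw [map_one, ← ContinuousLinearMap.adjoint_inner_left, one_apply_eq_self] at this
    rw [inner_zero_left, ← this, ← ContinuousLinearMap.adjoint_inner_right,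
      hpos.isSelfAdjoint.adjoint_eq]
  have h₃ := hasSum_single (f := fun α => inner ℂ (subspaceDefect n H M (coshift n H α
    (subspaceDefect n H M x))) (coshift n H α y)) 1 fun α hα => by
      rw [h₂ α hα, inner_zero_left]
  rw [h₁.unique h₃, coshift_one]
  rfl

theorem coe_defect_of_mem_range {w : M}
    (hw : w ∈ (defect (restrictedModel hM) : M →ₗ[ℂ] M).range) :
    subspaceDefect n H M w = w := by
  obtain ⟨z, rfl⟩ := hw
  change subspaceDefect n H M (defect (restrictedModel hM) z : M) =
    (defect (restrictedModel hM) z : M)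
  rw [← subspaceDefect_coe hM z, subspaceDefect_idem hM hpos]

/-- The translates of an orthonormal basis of the range of the defect operator form a Hilbert
basis. -/
theorem exists_hilbertBasis_restrictedModel (hfin : IsFiniteRank (subspaceDefect n H M)) :
    ∃ (b : HilbertBasis (Words n × Fin (tupleRank (restrictedModel hM))) ℂ M),
      (∀ α β l, wordOp (restrictedModel hM) α (b (β, l)) = b (α * β, l)) ∧
      (defect (restrictedModel hM) : M →ₗ[ℂ] M).range =
        Submodule.span ℂ (Set.range fun l => b (1, l)) := by
  have hfin' := isFiniteRank_defect hM hfin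
  set T := restrictedModel hM with hT
  set W := (defect T : M →ₗ[ℂ] M).range with hW
  have : FiniteDimensional ℂ W := hfin'
  let w : OrthonormalBasis (Fin (tupleRank T)) ℂ W := stdOrthonormalBasis ℂ W
  let v : Words n × Fin (tupleRank T) → M := fun p => wordOp T p.1 (w p.2)
  have hA : ∀ l, subspaceDefect n H M ((w l : M) : FockTensor n H) = (w l : M) := fun l =>
    coe_defect_of_mem_range hM hpos (w l).2
  have hvcoe : ∀ p, (v p : FockTensor n H) = shift n H p.1 ((w p.2 : M) : FockTensor n H) :=
    fun p => coe_wordOp_restrictedModel hM _ _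
  have hv : Orthonormal ℂ v := by
    refine ⟨fun p => ?_, fun p r hpr => ?_⟩
    · rw [Submodule.coe_norm, hvcoe, norm_shift_apply]
      exact w.orthonormal.1 p.2
    · change inner ℂ (v p) (v r) = 0
      rw [Submodule.coe_inner, hvcoe, hvcoe]
      by_cases h : p.1 = r.1
      · rw [← h, ← ContinuousLinearMap.adjoint_inner_left, ← mul_apply_eq_comp,
          coshift_mul_shift]
        exact w.orthonormal.2 fun h' => hpr (Prod.ext h h')
      · rw [← hA p.2, ← hA r.2]
        exact inner_shift_subspaceDefect hM hpos h _ _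
  have hspan : (Submodule.span ℂ (Set.range v))ᗮ = ⊥ := by
    rw [Submodule.eq_bot_iff]
    intro x hx
    obtain ⟨B, hB⟩ := exists_adjoint_comp_eq hpos
    have h₁ : ∀ α, ∀ y ∈ W, inner ℂ (y : FockTensor n H) (coshift n H α x) = 0 := by
      intro α y hy
      have h₂ : y = ∑ l, w.repr ⟨y, hy⟩ l • (w l : M) := by
        have := congrArg Subtype.val (w.sum_repr ⟨y, hy⟩)
        simpa using this.symm
      rw [h₂, Submodule.coe_sum, sum_inner]
      refine Finset.sum_eq_zero fun l _ => ?_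
      rw [Submodule.coe_smul, inner_smul_left, ContinuousLinearMap.adjoint_inner_right,
        ← hvcoe (α, l)]
      have := (Submodule.mem_orthogonal _ _).1 hx (v (α, l))
        (Submodule.subset_span ⟨_, rfl⟩)
      rw [← Submodule.coe_inner, this, mul_zero]
    -- Orthogonality to all translates makes every term in the expansion of `⟨x, x⟩` vanish, hence
    -- `x = 0`.
    have h₂ : ∀ α, subspaceDefect n H M (coshift n H α x) = 0 := by
      intro α
      refine ext_inner_left ℂ fun z => ?_
      rw [inner_zero_right, ← hpos.isSelfAdjoint.adjoint_eq,
        ContinuousLinearMap.adjoint_inner_right]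
      have h₃ : subspaceDefect n H M z ∈ W.map M.subtype := by
        rw [hW, hT, ← range_subspaceDefect hM]
        exact ⟨z, rfl⟩
      obtain ⟨y, hy, hyz⟩ := h₃
      rw [← hyz]
      exact h₁ α y hy
    have h₃ := hasSum_inner_coshift hB x.2 (x : FockTensor n H)
    simp only [h₂, inner_zero_left] at h₃
    have h₄ := h₃.unique hasSum_zero
    exact Subtype.ext (inner_self_eq_zero.1 h₄)
  refine ⟨HilbertBasis.mkOfOrthogonalEqBot hv hspan, fun α β l => ?_, ?_⟩
  · rw [HilbertBasis.coe_mkOfOrthogonalEqBot]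
    apply Subtype.ext
    rw [coe_wordOp_restrictedModel, hvcoe, hvcoe, map_mul]
    rfl
  · rw [HilbertBasis.coe_mkOfOrthogonalEqBot]
    have h₁ : (fun l => v (1, l)) = fun l => W.subtype (w l) := by
      funext l
      apply Subtype.ext
      rw [hvcoe, map_one]
      rfl
    rw [h₁, Set.range_comp' W.subtype w, ← Submodule.map_span, ← w.coe_toBasis,
      w.toBasis.span_eq, Submodule.map_top, Submodule.range_subtype]

end Wandering

/-! ### Tuples with a wandering basis -/

section WanderingBasis

variable {X : Type*} [NormedAddCommGroup X] [InnerProductSpace ℂ X] [CompleteSpace X]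
  {k : ℕ} {n : Fin k → ℕ} {T : OpTuple n X} {d : ℕ}

theorem finrank_levelSpan (b : HilbertBasis (Words n × Fin d) ℂ X)
    (hb : ∀ α β l, wordOp T α (b (β, l)) = b (α * β, l))
    (hT : (defect T : X →ₗ[ℂ] X).range = Submodule.span ℂ (Set.range fun l => b (1, l)))
    (q : Fin k → ℕ) :
    Module.finrank ℂ (levelSpan T q) =
      (∏ i, ∑ s ∈ Finset.range (q i + 1), n i ^ s) * d := by
  classical
  have h₁ : levelSpan T q = Submodule.span ℂ
      (Set.range fun p : ↥(wordBox n q ×ˢ (Finset.univ : Finset (Fin d))) => b p) := by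
    apply le_antisymm
    · refine Submodule.span_le.2 ?_
      rintro _ ⟨α, h, hα, hh, rfl⟩
      rw [hT] at hh
      have h₂ : wordOp T α h ∈ (Submodule.span ℂ (Set.range fun l => b (1, l))).map
          (wordOp T α : X →ₗ[ℂ] X) := ⟨h, hh, rfl⟩
      rw [Submodule.map_span] at h₂
      refine Submodule.span_mono ?_ h₂
      rintro _ ⟨_, ⟨l, rfl⟩, rfl⟩
      refine ⟨⟨(α, l), Finset.mem_product.2 ⟨mem_wordBox.2 hα, Finset.mem_univ _⟩⟩, ?_⟩
      exact ((hb α 1 l).trans (by rw [mul_one])).symm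
    · refine Submodule.span_le.2 ?_
      rintro _ ⟨⟨⟨α, l⟩, hp⟩, rfl⟩
      refine Submodule.subset_span ⟨α, b (1, l), ?_, ?_, ?_⟩
      · exact mem_wordBox.1 (Finset.mem_product.1 hp).1
      · rw [hT]; exact Submodule.subset_span ⟨l, rfl⟩
      · rw [hb, mul_one]
  have h₂ : LinearIndependent ℂ
      fun p : ↥(wordBox n q ×ˢ (Finset.univ : Finset (Fin d))) => b p :=
    b.orthonormal.linearIndependent.comp _ Subtype.val_injective
  rw [h₁, finrank_span_eq_card h₂, Fintype.card_coe, Finset.card_product, card_wordBox,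
    Finset.card_univ, Fintype.card_fin]

theorem hasEulerChar_of_hilbertBasis (b : HilbertBasis (Words n × Fin d) ℂ X)
    (hb : ∀ α β l, wordOp T α (b (β, l)) = b (α * β, l))
    (hT : (defect T : X →ₗ[ℂ] X).range = Submodule.span ℂ (Set.range fun l => b (1, l))) :
    HasEulerChar T d := by
  refine ⟨?_, fun q _ _ => ?_⟩
  · rw [IsFiniteRank, hT]
    exact FiniteDimensional.span_of_finite ℂ (Set.finite_range _)
  · have h : ∀ m, eulerRatio T (q m) = d := by
      intro m
      rw [eulerRatio, finrank_levelSpan b hb hT]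
      push_cast
      -- The term `s = 0` contributes `1`, so each factor of the denominator is positive.
      refine mul_div_cancel_left₀ _ (Finset.prod_ne_zero_iff.2 fun i _ => ne_of_gt ?_)
      rw [Finset.sum_range_succ']
      positivity
    simp only [h]
    exact tendsto_const_nhds

theorem HasEulerChar.eulerChar_eq {c : ℝ} (h : HasEulerChar T c) : eulerChar T = c :=
  (Classical.epsilon_spec (p := HasEulerChar T) ⟨c, h⟩).unique h

end WanderingBasis

/-! ### Unitary equivalence by matching wandering bases -/

section Equivalence

variable {X Y : Type*} [NormedAddCommGroup X] [InnerProductSpace ℂ X]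
  [NormedAddCommGroup Y] [InnerProductSpace ℂ Y]
  {k : ℕ} {n : Fin k → ℕ} {T : OpTuple n X} {T' : OpTuple n Y} {d : ℕ}

theorem unitarilyEquivalent_of_hilbertBasis (b : HilbertBasis (Words n × Fin d) ℂ X)
    (hb : ∀ α β l, wordOp T α (b (β, l)) = b (α * β, l))
    {d' : ℕ} (hd : d = d')
    (b' : HilbertBasis (Words n × Fin d') ℂ Y)
    (hb' : ∀ α β l, wordOp T' α (b' (β, l)) = b' (α * β, l)) :
    UnitarilyEquivalent T T' := by
  classical
  subst hd
  let U : X ≃ₗᵢ[ℂ] Y := b.repr.trans b'.repr.symm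
  have hU : ∀ p, U (b p) = b' p := fun p => by
    change b'.repr.symm (b.repr (b p)) = b' p
    rw [b.repr_self, b'.repr_symm_single]
  refine ⟨U, fun i j x => ?_⟩
  -- By continuity it suffices to compare on basis vectors, where both tuples prepend the same
  -- letter to the index.
  have h : (U.toContinuousLinearEquiv : X →L[ℂ] Y) ∘L T i j =
      T' i j ∘L (U.toContinuousLinearEquiv : X →L[ℂ] Y) := by
    refine ContinuousLinearMap.ext_on
      (Submodule.dense_iff_topologicalClosure_eq_top.2 b.dense_span) ?_
    rintro _ ⟨⟨β, l⟩, rfl⟩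
    change U (T i j (b (β, l))) = T' i j (U (b (β, l)))
    rw [hU, ← wordOp_mulSingle_of T, ← wordOp_mulSingle_of T', hb, hb', hU]
  exact DFunLike.congr_fun h x

end Equivalence

end

end Polyball

theorem theorem2p2 {k : ℕ} (hk : 1 ≤ k) (n : Fin k → ℕ) (hn : ∀ i, 2 ≤ n i)
    (H : Type*) [NormedAddCommGroup H] [InnerProductSpace ℂ H] [CompleteSpace H]
    (M N : Submodule ℂ (Polyball.FockTensor n H)) [CompleteSpace M] [CompleteSpace N]
    (hM : Polyball.IsInvariant (Polyball.universalModel n H) M)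
    (hN : Polyball.IsInvariant (Polyball.universalModel n H) N)
    (hMred : Polyball.ContainsNoReducing (Polyball.universalModel n H) M)
    (hNred : Polyball.ContainsNoReducing (Polyball.universalModel n H) N)
    (hMpos : (Polyball.subspaceDefect n H M).IsPositive)
    (hNpos : (Polyball.subspaceDefect n H N).IsPositive)
    (hMfin : Polyball.IsFiniteRank (Polyball.subspaceDefect n H M))
    (hNfin : Polyball.IsFiniteRank (Polyball.subspaceDefect n H N)) :
    (Polyball.HasEulerChar (Polyball.restrictedModel hM)
        (Polyball.eulerChar (Polyball.restrictedModel hM)) ∧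
      Polyball.eulerChar (Polyball.restrictedModel hM) =
        Polyball.tupleRank (Polyball.restrictedModel hM)) ∧
    (Polyball.HasEulerChar (Polyball.restrictedModel hN)
        (Polyball.eulerChar (Polyball.restrictedModel hN)) ∧
      Polyball.eulerChar (Polyball.restrictedModel hN) =
        Polyball.tupleRank (Polyball.restrictedModel hN)) ∧
    (Polyball.UnitarilyEquivalent (Polyball.restrictedModel hM) (Polyball.restrictedModel hN) ↔
      Polyball.eulerChar (Polyball.restrictedModel hM) =
        Polyball.eulerChar (Polyball.restrictedModel hN)) := by
  obtain ⟨b, hb, hbT⟩ := Polyball.exists_hilbertBasis_restrictedModel hM hMpos hMfin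
  obtain ⟨c, hc, hcT⟩ := Polyball.exists_hilbertBasis_restrictedModel hN hNpos hNfin
  have hχM := Polyball.hasEulerChar_of_hilbertBasis b hb hbT
  have hχN := Polyball.hasEulerChar_of_hilbertBasis c hc hcT
  have eM := hχM.eulerChar_eq
  have eN := hχN.eulerChar_eq
  refine ⟨⟨by rwa [eM], eM⟩, ⟨by rwa [eN], eN⟩, fun h => ?_, fun h => ?_⟩
  · rw [eM, eN, h.tupleRank_eq]
  · rw [eM, eN, Nat.cast_inj] at h
    exact Polyball.unitarilyEquivalent_of_hilbertBasis b hb h c hc
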